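/- **Setting.** A wireless device-to-device network consists of $n$ users placed in the plane. Under the protocol model with transmission range $r>0$, guard parameter $\Delta>0$ and link rate $C_r>0$, a transmission from $u$ to $v$ succeeds iff $v$ is within distance $r$ of $u$ and at distance at least $(1+\Delta)r$ from every other active transmitter; an active transmitter sends $C_r$ bits per channel use. There is a library of $m\ge 1$ independent, uniformly distributed files of $F$ bits; each user caches at most $MF$ bits and requests one file (arbitrary demands). The per user throughput of a scheme is $T=F/D$, where $D$ is the number of channel uses needed to satisfy all requests; a throughput $T$ is achieved if, as $F\to\infty$, the worst-case error probability has limit superior at most $\varepsilon$ for each prescribed $\varepsilon>0$ and $\limsup D/F\le 1/T$. The users are partitioned into clusters of $g_c$ users each, any two users of a cluster being at distance at most $r$, and users receive messages only from users of their own cluster. The clusters are grouped into $\mathcal K$ reuse sets such that users in different clusters of the same reuse set are at distance at least $(1+\Delta)r$ from each other. A graph is a $(\gamma,\tau)$-Ruzsa–Szemerédi (RS) graph if its edge set is the union of $\tau$ pairwise disjoint induced matchings of $\gamma$ edges each. **RS scheme.** Put $t_c=g_cM/m$, and let $G$ be a $(\gamma,\tau)$-RS graph with $\gamma,\tau\ge1$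 on the $g_c$ users of a cluster in which every vertex has degree at least $g_c-t_c$. Each file is split into $K$ equal packets, each vertex of $G$ representing $2\gamma-1$ of them, and a user stores the packets of all files represented by the vertices not adjacent to it (itself included). In delivery, for each of the $\tau$ matchings, fix for each of its vertices $x$ a bijection from the $2\gamma-1$ other vertices of the matching to the packets represented by the vertex matched to $x$; then each vertex $w$ of the matching multicasts, inside its cluster, the XOR over the other vertices $x$ of the packet assigned to $w$ by the bijection of $x$, taken from the file requested by $x$. **Theorem.** Let $r<\sqrt2$, let $g_c=\Lambda^z$ with integers $\Lambda\ge 2$ and $z\ge 2\Lambda$, and let $$M\ \ge\ 2m\,g_c^{-\frac{1}{2\Lambda^4\ln\Lambda}} .$$ Then RS graphs as required by the scheme exist, and for every such graph $G$ and every choice of the bijections, the RS scheme applied in every cluster uses $K=(2\gamma-1)g_c$ packets per file and achieves the per user throughput $$T_c^{\rm RS}(M)=\frac{C_r}{\mathcal K}\cdot\frac{g_c}{\tau}\cdot\frac{2\gamma-1}{2\gamma}.$$ -/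

import Mathlib

noncomputable section

/-! ### The wireless network: protocol model and transmission policies -/

/-- A single-hop D2D network on the user set `U` under the protocol model: user positions in the
plane, transmission range `r`, guard parameter `Δ`, and the constant link rate `C_r`
(coded bits carried by one active transmitter in one channel use). -/
structure D2DNetwork (U : Type*) where
  pos : U → EuclideanSpace ℝ (Fin 2)
  r : ℝ
  Δ : ℝ
  linkRate : ℝ
  r_pos : 0 < r
  Δ_pos : 0 < Δ
  linkRate_pos : 0 < linkRate

/-- `u` transmits in the activation set `A`; a directed link is a pair (transmitter, receiver). -/
def Transmits {U : Type*} (A : Set (U × U)) (u : U) : Prop := ∃ v, (u, v) ∈ A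

/-- The set `A` of simultaneously active links obeys the protocol model: for every active link
`u → v` the distance from `u` to `v` is at most `r`, and `v` is at distance at least `(1 + Δ) r`
from every active transmitter other than `u`. -/
def D2DNetwork.Feasible {U : Type*} (net : D2DNetwork U) (A : Set (U × U)) : Prop :=
  ∀ u v, (u, v) ∈ A →
    u ≠ v ∧ dist (net.pos u) (net.pos v) ≤ net.r ∧
      ∀ u', u' ≠ u → Transmits A u' →
        (1 + net.Δ) * net.r ≤ dist (net.pos u') (net.pos v)

/-- The users are the pairs (cluster, label inside the cluster), so that all clusters have the same
number of users. `reuse` groups the clusters into `k` reuse sets. Every two users of one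
cluster are in range of each other, and clusters of the same reuse set do not interfere. -/
structure D2DNetwork.IsReusePattern {ι V : Type*} (net : D2DNetwork (ι × V)) {k : ℕ}
    (reuse : ι → Fin k) : Prop where
  in_range : ∀ c v w, dist (net.pos (c, v)) (net.pos (c, w)) ≤ net.r
  separated : ∀ c c', c ≠ c' → reuse c = reuse c' → ∀ v w,
    (1 + net.Δ) * net.r ≤ dist (net.pos (c, v)) (net.pos (c', w))

/-! ### Caching schemes -/

/-- The library: `m` files, each split into packets indexed by `P`, of `b` bits each. The file size
is `F = |P| * b` bits. -/
abbrev Library (m : ℕ) (P : Type*) (b : ℕ) : Type _ := Fin m → P → Fin b → ZMod 2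

/-- Placement and delivery functions. -/
structure D2DScheme (U : Type*) (m : ℕ) (P : Type*) (b : ℕ) where
  /-- the packets (file, packet index) stored by a user -/
  cache : U → Set (Fin m × P)
  /-- the users whose messages are to be received by a given user -/
  heard : U → Set U
  /-- the positions of the coded bits sent by a user -/
  Bit : U → Type
  bitFintype : ∀ u, Fintype (Bit u)
  /-- the coded bits of a user, from its cache content and the demands of all users -/
  encode : ∀ u, (cache u → Fin b → ZMod 2) → (U → Fin m) → Bit u → ZMod 2

namespace D2DScheme

variable {U : Type*} {m : ℕ} {P : Type*} {b : ℕ}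

/-- The content of the cache of `u`. -/
def content (S : D2DScheme U m P b) (W : Library m P b) (u : U) :
    S.cache u → Fin b → ZMod 2 := fun p => W p.1.1 p.1.2

/-- The message sent by `u`. -/
def message (S : D2DScheme U m P b) (W : Library m P b) (d : U → Fin m) (u : U) :
    S.Bit u → ZMod 2 := S.encode u (S.content W u) d

/-- The number of coded bits sent by `u`. -/
def numBits (S : D2DScheme U m P b) (u : U) : ℕ := @Fintype.card (S.Bit u) (S.bitFintype u)

/-- Decoding functions: each user computes a file from the messages it receives, its own cache
content and the demands. -/
def Decoder (S : D2DScheme U m P b) : Type _ :=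
  ∀ u, (∀ v : S.heard u, S.Bit v → ZMod 2) → (S.cache u → Fin b → ZMod 2) → (U → Fin m) →
    P → Fin b → ZMod 2

/-- The file reconstructed by `u`. -/
def decoded (S : D2DScheme U m P b) (dec : S.Decoder) (W : Library m P b) (d : U → Fin m)
    (u : U) : P → Fin b → ZMod 2 :=
  dec u (fun v => S.message W d v) (S.content W u) d

/-- The worst case over demands and users of the probability of a decoding error, when the files are
independent and uniformly distributed. -/
def errorProb (S : D2DScheme U m P b) (dec : S.Decoder) : ℝ :=
  ⨆ d : U → Fin m, ⨆ u : U,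
    (Set.ncard {W : Library m P b | S.decoded dec W d u ≠ W (d u)} : ℝ) /
      (Nat.card (Library m P b) : ℝ)

/-- The activation sets `A 0, …, A (D - 1)` form a transmission policy that obeys the protocol model
and delivers every message to every user that is to receive it, in `D` channel uses. A user sends its
coded bits in order, `C_r` of them in each channel use in which it transmits. -/
def Delivers (net : D2DNetwork U) (S : D2DScheme U m P b) (D : ℕ) (A : ℕ → Set (U × U)) : Prop :=
  (∀ t < D, net.Feasible (A t)) ∧
    ∀ v, ∀ u ∈ S.heard v,
      (∀ t < D, Transmits (A t) u → (u, v) ∈ A t) ∧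
        (S.numBits u : ℝ) ≤ net.linkRate * (Set.ncard {t | t < D ∧ Transmits (A t) u} : ℝ)

end D2DScheme

/-- The schemes `S b`, which split every file into `K = |P|` packets (of `b` bits, so that the file
size is `F = K * b`), achieve the per user throughput `T` with a cache of `M` files per user:
every user stores at most `M * K` packets, and for each `ε > 0` there are decoding functions and
transmission policies such that, as `F → ∞`, the limit superior of the worst-case error probability is
at most `ε` and the limit superior of `D / F` is at most `1 / T`, where `D` is the number of
channel uses. -/
def AchievesThroughput {U : Type*} {m : ℕ} {P : Type*} [Fintype P] (net : D2DNetwork U)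
    (M T : ℝ) (S : ∀ b : ℕ, D2DScheme U m P b) : Prop :=
  (∀ b u, (Set.ncard ((S b).cache u) : ℝ) ≤ M * Fintype.card P) ∧
    ∀ ε > 0, ∃ (dec : ∀ b, (S b).Decoder) (D : ℕ → ℕ) (A : ℕ → ℕ → Set (U × U)),
      (∀ b, (S b).Delivers net (D b) (A b)) ∧
      (∀ η > 0, ∀ᶠ b in Filter.atTop, (S b).errorProb (dec b) ≤ ε + η) ∧
      (∀ η > 0, ∀ᶠ b in Filter.atTop,
        (D b : ℝ) ≤ (1 / T + η) * ((Fintype.card P : ℝ) * (b : ℝ)))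

/-! ### Ruzsa-Szemerédi graphs and the scheme built from them -/

/-- The edge set of `G` is the union of the `τ` pairwise disjoint induced matchings `N 0, …`,
each with `γ` edges: `G` is a `(γ, τ)`-Ruzsa-Szemerédi graph. -/
structure IsRSDecomposition {V : Type*} (G : SimpleGraph V) (γ : ℕ) {τ : ℕ}
    (N : Fin τ → G.Subgraph) : Prop where
  isMatching : ∀ l, (N l).IsMatching
  isInduced : ∀ l, (N l).IsInduced
  card_edges : ∀ l, (N l).edgeSet.ncard = γ
  disjoint : Pairwise fun l l' => Disjoint (N l).edgeSet (N l').edgeSet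
  cover : ⋃ l, (N l).edgeSet = G.edgeSet

/-- For each matching `l` and each vertex `u` of it, `σ l u` numbers the other `2γ - 1` vertices of
the matching: `σ l u w` is the index of the packet that `w` contributes to `u`. -/
def IsPacketLabelling {V : Type*} {G : SimpleGraph V} {γ τ : ℕ} (N : Fin τ → G.Subgraph)
    (σ : Fin τ → V → V → Fin (2 * γ - 1)) : Prop :=
  ∀ l, ∀ u ∈ (N l).verts, Set.BijOn (σ l u) ((N l).verts \ {u}) Set.univ

open Classical in
/-- The Ruzsa-Szemerédi scheme in every cluster. Vertices are the labels of the users inside a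
cluster, and each vertex represents `2γ - 1` packets of each file.

Placement: user `(c, v)` stores the packets of all vertices that are not adjacent to `v` (`v` itself
being one of them).

Delivery: for each matching `l` that contains the vertex `w`, user `(c, w)` sends the XOR, over the
other vertices `x` of the matching, of the packet numbered `σ l x w` of the vertex `y` matched to
`x`, taken from the file requested by `(c, x)`. The induced matching property makes all these packets
available in the cache of `(c, w)`, so that the alternative `0` never occurs. Messages are received
by the users of the same cluster only. -/
def rsScheme (ι : Type*) {V : Type*} [Fintype V] {G : SimpleGraph V} {γ τ : ℕ} (m : ℕ)
    (N : Fin τ → G.Subgraph) (σ : Fin τ → V → V → Fin (2 * γ - 1)) (b : ℕ) :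
    D2DScheme (ι × V) m (V × Fin (2 * γ - 1)) b where
  cache := fun u => {p | ¬ G.Adj u.2 p.2.1}
  heard := fun u => {v | v.1 = u.1 ∧ v ≠ u}
  Bit := fun u => {l : Fin τ // u.2 ∈ (N l).verts} × Fin b
  bitFintype := fun _ => inferInstance
  encode := fun u Z d i =>
    ∑ x : V, ∑ y : V,
      if x ≠ u.2 ∧ (N i.1.1).Adj x y then
        if h : (d (u.1, x), (y, σ i.1.1 x u.2)) ∈
            {p : Fin m × (V × Fin (2 * γ - 1)) | ¬ G.Adj u.2 p.2.1} then
          Z ⟨_, h⟩ i.2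
        else 0
      else 0

end

open Filter

/-! ### Matchings and Ruzsa-Szemerédi decompositions -/

/-! Decoding rests on one fact: in an induced matching, a vertex `w` is not adjacent to the partner
of any other vertex `x`, so `w` stores that partner's packets. Hence `w` can form its XOR, and a
receiver `u` of the same matching knows every summand except the one meant for it. As `w` runs over
the other vertices, the bijection of `u` yields every packet of its partner; since the matchings
cover all edges, every packet missing at `u` is recovered without error
(`rsScheme_eq_of_message_eq`).

The rate is a count. A user sends `b` bits per matching through its vertex, and there are `2γτ`
incidences, so a cluster sends `2γτb` bits. Time division over reuse sets and labels
(`exists_timeDivision`) takes `κ · 2γτb / C_r` channel uses, up to a rounding cost independent of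
`b`. Dividing `F = (2γ - 1) g_c b` by this gives the throughput.

For existence any admissible graph suffices: the complete graph, split into single edges, has degree
`g_c - 1`, and the bound on `M` gives `t_c ≥ 1`. -/

theorem SimpleGraph.Subgraph.IsMatching.ncard_verts {V : Type*} [Finite V] {G : SimpleGraph V}
    {H : G.Subgraph} (hH : H.IsMatching) : H.verts.ncard = 2 * H.edgeSet.ncard := by
  classical
  have := Fintype.ofFinite V
  have hE : H.edgeSet.ncard = H.spanningCoe.edgeFinset.card := by
    rw [← Set.ncard_coe_finset, SimpleGraph.coe_edgeFinset]
    rfl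
  rw [hE, SimpleGraph.two_mul_card_edgeFinset, Set.ncard_eq_toFinset_card']
  symm
  -- Twice the number of edges counts ordered adjacent pairs; in a matching such a pair is
  -- determined by its first entry.
  refine Finset.card_bij (fun p _ => p.1) ?_ ?_ ?_
  · rintro ⟨x, y⟩ h
    simp only [Finset.mem_filter_univ, SimpleGraph.Subgraph.spanningCoe_adj] at h
    simpa using h.fst_mem
  · rintro ⟨x, y⟩ h ⟨x', y'⟩ h' rfl
    simp only [Finset.mem_filter_univ, SimpleGraph.Subgraph.spanningCoe_adj] at h h'
    rw [hH.eq_of_adj_left h h']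
  · intro x hx
    obtain ⟨y, hy, -⟩ := hH (Set.mem_toFinset.1 hx)
    exact ⟨(x, y), by simpa using hy, rfl⟩

/-- In an induced matching the partner of a vertex other than `w` is not adjacent to `w`. -/
theorem SimpleGraph.Subgraph.IsMatching.not_adj_of_isInduced {V : Type*} {G : SimpleGraph V}
    {H : G.Subgraph} (hH : H.IsMatching) (hI : H.IsInduced) {w x y : V} (hw : w ∈ H.verts)
    (hxy : H.Adj x y) (hne : x ≠ w) : ¬ G.Adj w y := fun h =>
  hne (hH.eq_of_adj_right hxy (hI hw hxy.snd_mem h))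

/-- The edges of a finite graph, taken one at a time, form a Ruzsa-Szemerédi decomposition. -/
theorem exists_isRSDecomposition_one {V : Type*} [Finite V] (G : SimpleGraph V) :
    ∃ N : Fin G.edgeSet.ncard → G.Subgraph, IsRSDecomposition G 1 N := by
  have key : ∀ e : G.edgeSet, ∃ H : G.Subgraph, H.IsMatching ∧ H.IsInduced ∧ H.edgeSet = {e.1} := by
    rintro ⟨e, he⟩
    induction e with
    | h a b =>
      have hab : G.Adj a b := he
      refine ⟨G.subgraphOfAdj hab, .subgraphOfAdj hab, ?_, G.edgeSet_subgraphOfAdj hab⟩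
      intro x hx y hy hxy
      simp only [SimpleGraph.subgraphOfAdj_verts, Set.mem_insert_iff, Set.mem_singleton_iff]
        at hx hy
      rcases hx with rfl | rfl <;> rcases hy with rfl | rfl <;> simp_all
  choose H hM hI hE using key
  let e : Fin G.edgeSet.ncard ≃ G.edgeSet := (Finite.equivFin G.edgeSet).symm
  refine ⟨fun l => H (e l), fun l => hM _, fun l => hI _, fun l => by simp [hE], ?_, ?_⟩
  · intro l l' hl
    simp only [hE, Set.disjoint_singleton]
    exact fun h => hl (e.injective (Subtype.ext h))
  · ext s
    simp only [hE, Set.mem_iUnion, Set.mem_singleton_iff]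
    exact ⟨by rintro ⟨l, rfl⟩; exact (e l).2, fun hs => ⟨e.symm ⟨s, hs⟩, by simp⟩⟩

namespace IsRSDecomposition

variable {V : Type*} [Finite V] {G : SimpleGraph V} {γ τ : ℕ} {N : Fin τ → G.Subgraph}

theorem ncard_verts (h : IsRSDecomposition G γ N) (l : Fin τ) : (N l).verts.ncard = 2 * γ := by
  rw [(h.isMatching l).ncard_verts, h.card_edges]

theorem exists_isPacketLabelling (h : IsRSDecomposition G γ N) (hγ : 1 ≤ γ) :
    ∃ σ : Fin τ → V → V → Fin (2 * γ - 1), IsPacketLabelling N σ := by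
  have : Nonempty (Fin (2 * γ - 1)) := ⟨⟨0, by omega⟩⟩
  have key : ∀ l u, ∃ f : V → Fin (2 * γ - 1),
      u ∈ (N l).verts → Set.BijOn f ((N l).verts \ {u}) Set.univ := by
    intro l u
    by_cases hu : u ∈ (N l).verts
    · have hc : ((N l).verts \ {u}).encard = (Set.univ : Set (Fin (2 * γ - 1))).encard := by
        rw [← (Set.toFinite _).cast_ncard_eq, ← (Set.toFinite _).cast_ncard_eq,
          Set.ncard_sdiff_singleton_of_mem hu, h.ncard_verts, Set.ncard_univ, Nat.card_fin]
      obtain ⟨f, hf⟩ := (Set.toFinite ((N l).verts \ {u})).exists_bijOn_of_encard_eq hc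
      exact ⟨f, fun _ => hf⟩
    -- Off the matching the value is junk, but it needs `Fin (2 * γ - 1)` to be inhabited, hence `1
    -- ≤ γ`.
    · exact ⟨fun _ => Classical.arbitrary _, fun h => absurd h hu⟩
  choose σ hσ using key
  exact ⟨σ, hσ⟩

/-- Double counting of the incidences between vertices and matchings. -/
theorem sum_card_matchings [Fintype V] (h : IsRSDecomposition G γ N) :
    ∑ w : V, Nat.card {l : Fin τ // w ∈ (N l).verts} = 2 * γ * τ := by
  classical
  simp_rw [Nat.card_eq_fintype_card, Fintype.card_subtype, Finset.card_filter]
  rw [Finset.sum_comm]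
  have : ∀ l : Fin τ, ∑ w : V, (if w ∈ (N l).verts then 1 else 0) = 2 * γ := fun l => by
    rw [← h.ncard_verts l, Set.ncard_eq_toFinset_card', ← Finset.card_filter]
    congr 1
    ext
    simp
  simp [this, mul_comm]

end IsRSDecomposition

/-! ### Cache sizes -/

theorem ncard_rsScheme_cache {ι V : Type*} [Fintype V] {G : SimpleGraph V} {γ τ m : ℕ}
    (N : Fin τ → G.Subgraph) (σ : Fin τ → V → V → Fin (2 * γ - 1)) (b : ℕ) (u : ι × V) :
    ((rsScheme ι m N σ b).cache u).ncard
      = m * ((Fintype.card V - (G.neighborSet u.2).ncard) * (2 * γ - 1)) := by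
  have : (rsScheme ι m N σ b).cache u
      = (Set.univ : Set (Fin m)) ×ˢ ((G.neighborSet u.2)ᶜ ×ˢ
        (Set.univ : Set (Fin (2 * γ - 1)))) := by
    ext p
    simp [rsScheme]
  rw [this, Set.ncard_prod, Set.ncard_prod, Set.ncard_univ, Set.ncard_univ, Set.ncard_compl]
  simp

/-- The degree bound leaves at most `t_c = |V| M / m` non-neighbours, the vertex itself included,
each representing `2γ - 1` packets of each of the `m` files. -/
theorem ncard_rsScheme_cache_le {ι V : Type*} [Fintype V] {G : SimpleGraph V} {γ τ m : ℕ}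
    (hm : 0 < m) {M : ℝ}
    (hdeg : ∀ v, (Fintype.card V : ℝ) - (Fintype.card V : ℝ) * M / (m : ℝ)
        ≤ ((G.neighborSet v).ncard : ℝ))
    (N : Fin τ → G.Subgraph) (σ : Fin τ → V → V → Fin (2 * γ - 1)) (b : ℕ) (u : ι × V) :
    (((rsScheme ι m N σ b).cache u).ncard : ℝ)
      ≤ M * Fintype.card (V × Fin (2 * γ - 1)) := by
  have hle : (G.neighborSet u.2).ncard ≤ Fintype.card V := by
    rw [← Nat.card_eq_fintype_card]
    exact Set.ncard_le_card _
  have hm' : (0 : ℝ) < m := by exact_mod_cast hm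
  rw [ncard_rsScheme_cache, Fintype.card_prod, Fintype.card_fin]
  push_cast [Nat.cast_sub hle]
  rw [← mul_assoc, ← mul_assoc]
  refine mul_le_mul_of_nonneg_right ?_ (Nat.cast_nonneg _)
  calc (m : ℝ) * (Fintype.card V - (G.neighborSet u.2).ncard)
      ≤ m * (Fintype.card V * M / m) := by
        gcongr
        linarith [hdeg u.2]
    _ = M * Fintype.card V := by field_simp

/-! ### Zero-error decoding -/

namespace D2DScheme

variable {U : Type*} {m : ℕ} {P : Type*} {b : ℕ}

/-- If the received messages and the cache content determine the requested file, then some decoder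
never errs. -/
theorem exists_decoder_errorProb_eq_zero (S : D2DScheme U m P b)
    (h : ∀ (W W' : Library m P b) (d : U → Fin m) (u : U),
      (∀ v ∈ S.heard u, S.message W d v = S.message W' d v) →
        S.content W u = S.content W' u → W (d u) = W' (d u)) :
    ∃ dec : S.Decoder, S.errorProb dec = 0 := by
  classical
  -- Choose any library consistent with what `u` observes; by `h` the requested file does not depend
  -- on the choice.
  let dec : S.Decoder := fun u msg cont d =>
    if hW : ∃ W : Library m P b,
        (fun v : S.heard u => S.message W d v) = msg ∧ S.content W u = cont
    then hW.choose (d u) else 0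
  have hdec : ∀ W d u, S.decoded dec W d u = W (d u) := by
    intro W d u
    have hW : ∃ W' : Library m P b, (fun v : S.heard u => S.message W' d v)
        = (fun v : S.heard u => S.message W d v) ∧ S.content W' u = S.content W u :=
      ⟨W, rfl, rfl⟩
    simp only [decoded, dec, dif_pos hW]
    exact h _ _ d u (fun v hv => congrFun hW.choose_spec.1 ⟨v, hv⟩) hW.choose_spec.2
  exact ⟨dec, by simp [errorProb, hdec]⟩

end D2DScheme

/-- Inducedness makes the cache test in `encode` always succeed. Summing over ordered pairs lets a
receiver single out one summand. -/
theorem message_rsScheme {ι V : Type*} [Fintype V] {G : SimpleGraph V} {γ τ m b : ℕ}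
    {N : Fin τ → G.Subgraph} (hN : IsRSDecomposition G γ N)
    (σ : Fin τ → V → V → Fin (2 * γ - 1)) (W : Library m (V × Fin (2 * γ - 1)) b)
    (d : ι × V → Fin m) (u : ι × V) (i : (rsScheme ι m N σ b).Bit u) :
    (rsScheme ι m N σ b).message W d u i = open Classical in
      ∑ p : V × V, if p.1 ≠ u.2 ∧ (N i.1.1).Adj p.1 p.2 then
        W (d (u.1, p.1)) (p.2, σ i.1.1 p.1 u.2) i.2 else 0 := by
  classical
  rw [Fintype.sum_prod_type]
  refine Finset.sum_congr rfl fun x _ => Finset.sum_congr rfl fun y _ => ?_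
  by_cases hc : x ≠ u.2 ∧ (N i.1.1).Adj x y
  · have hn : ¬ G.Adj u.2 y :=
      (hN.isMatching i.1.1).not_adj_of_isInduced (hN.isInduced i.1.1) i.1.2 hc.2 hc.1
    rw [if_pos hc, if_pos hc, dif_pos (by exact hn)]
    rfl
  · rw [if_neg hc, if_neg hc]

theorem rsScheme_eq_of_message_eq {ι V : Type*} [Fintype V] {G : SimpleGraph V} {γ τ m b : ℕ}
    {N : Fin τ → G.Subgraph} (hN : IsRSDecomposition G γ N)
    {σ : Fin τ → V → V → Fin (2 * γ - 1)} (hσ : IsPacketLabelling N σ)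
    (W W' : Library m (V × Fin (2 * γ - 1)) b) (d : ι × V → Fin m) (u : ι × V)
    (hmsg : ∀ v ∈ (rsScheme ι m N σ b).heard u,
      (rsScheme ι m N σ b).message W d v = (rsScheme ι m N σ b).message W' d v)
    (hcont : (rsScheme ι m N σ b).content W u = (rsScheme ι m N σ b).content W' u) :
    W (d u) = W' (d u) := by
  classical
  have hcache : ∀ f y p, ¬ G.Adj u.2 y → W f (y, p) = W' f (y, p) := fun f y p hy =>
    congrFun hcont ⟨(f, (y, p)), hy⟩
  funext ⟨y, p⟩
  by_cases hy : G.Adj u.2 y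
  swap
  · exact hcache _ _ _ hy
  funext j
  have hmem : s(u.2, y) ∈ ⋃ l, (N l).edgeSet := hN.cover ▸ hy
  obtain ⟨l, hl⟩ := Set.mem_iUnion.1 hmem
  have hl : (N l).Adj u.2 y := hl
  obtain ⟨w, ⟨hw, hwu⟩, rfl⟩ := (hσ l u.2 hl.fst_mem).surjOn (Set.mem_univ p)
  have hwu : w ≠ u.2 := hwu
  have hv : ((u.1, w) : ι × V) ∈ (rsScheme ι m N σ b).heard u :=
    ⟨rfl, fun h => hwu (congrArg Prod.snd h)⟩
  have hsum := (message_rsScheme hN σ W d (u.1, w) (⟨l, hw⟩, j)).symm.trans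
    ((congrFun (hmsg _ hv) (⟨l, hw⟩, j)).trans
      (message_rsScheme hN σ W' d (u.1, w) (⟨l, hw⟩, j)))
  -- The summand of `(u.2, y)` is the wanted packet; all others agree for `W` and `W'` and cancel.
  rw [← Finset.add_sum_erase _ _ (Finset.mem_univ (u.2, y)),
    ← Finset.add_sum_erase _ _ (Finset.mem_univ (u.2, y))] at hsum
  have hrest : ∀ q ∈ Finset.univ.erase (u.2, y),
      (if q.1 ≠ w ∧ (N l).Adj q.1 q.2 then W (d (u.1, q.1)) (q.2, σ l q.1 w) j else 0)
        = if q.1 ≠ w ∧ (N l).Adj q.1 q.2 then W' (d (u.1, q.1)) (q.2, σ l q.1 w) j else 0 := by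
    rintro ⟨x, z⟩ hq
    refine ite_congr rfl (fun hc => ?_) fun _ => rfl
    -- If `x` were `u.2`, its partner `z` would be `y`, the erased pair. So `x` is another vertex,
    -- and the packets of `z` are cached at `u`.
    have hxu : x ≠ u.2 := by
      rintro rfl
      exact Finset.ne_of_mem_erase hq
        (Prod.ext rfl ((hN.isMatching l).eq_of_adj_left hc.2 hl))
    exact congrFun (hcache _ _ _ ((hN.isMatching l).not_adj_of_isInduced (hN.isInduced l)
      hl.fst_mem hc.2 hxu)) j
  simp only at hsum
  rw [Finset.sum_congr rfl hrest, if_pos ⟨hwu.symm, hl⟩, if_pos ⟨hwu.symm, hl⟩] at hsum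
  exact add_right_cancel hsum

/-! ### Scheduling -/

/-- Time division: the pairs (reuse set, label) take turns, the label `w` getting `s w` turns in each
reuse set. -/
theorem exists_timeDivision {ι V : Type*} [Fintype V] [Nontrivial V]
    {net : D2DNetwork (ι × V)} {k : ℕ} {reuse : ι → Fin k} (hreuse : net.IsReusePattern reuse)
    (s : V → ℕ) :
    ∃ A : ℕ → Set ((ι × V) × (ι × V)),
      (∀ t, net.Feasible (A t)) ∧
      (∀ t (u v : ι × V), v.1 = u.1 → v ≠ u → Transmits (A t) u → (u, v) ∈ A t) ∧
      ∀ u, Set.ncard {t | t < k * ∑ w, s w ∧ Transmits (A t) u} = s u.2 := by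
  classical
  set D := k * ∑ w, s w with hD
  -- A channel use is a triple (reuse set, label, turn); `e` numbers these triples.
  have hcard : Fintype.card (Σ p : Fin k × V, Fin (s p.2)) = D := by
    simp [Fintype.card_sigma, Fintype.sum_prod_type, hD]
  let e : (Σ p : Fin k × V, Fin (s p.2)) ≃ Fin D := Fintype.equivFinOfCardEq hcard
  let A : ℕ → Set ((ι × V) × (ι × V)) := fun t =>
    {l | (∃ h : t < D, (e.symm ⟨t, h⟩).1 = (reuse l.1.1, l.1.2)) ∧ l.2.1 = l.1.1 ∧ l.2 ≠ l.1}
  have htr : ∀ t u, Transmits (A t) u ↔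
      ∃ h : t < D, (e.symm ⟨t, h⟩).1 = (reuse u.1, u.2) := by
    intro t u
    constructor
    · rintro ⟨v, hv, -⟩
      exact hv
    · intro h
      -- Transmitting requires an active link, so a cluster needs a second user.
      obtain ⟨w, hw⟩ := exists_ne u.2
      exact ⟨(u.1, w), h, rfl, fun h => hw (congrArg Prod.snd h)⟩
  refine ⟨A, ?_, ?_, ?_⟩
  · rintro t ⟨c, x⟩ ⟨c', y⟩ ⟨⟨h, hu⟩, hc, hne⟩
    obtain rfl : c' = c := hc
    refine ⟨hne.symm, hreuse.in_range _ _ _, ?_⟩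
    rintro ⟨c₂, x₂⟩ hne₂ ht
    obtain ⟨_, h₂⟩ := (htr _ _).1 ht
    rw [hu, Prod.mk.injEq] at h₂
    -- Simultaneous transmitters share reuse set and label, so distinct ones lie in different,
    -- separated clusters.
    refine hreuse.separated _ _ ?_ h₂.1.symm _ _
    rintro rfl
    exact hne₂ (Prod.ext rfl h₂.2.symm)
  · intro t u v h1 h2 h3
    exact ⟨(htr t u).1 h3, h1, h2⟩
  · intro u
    have : {t | t < D ∧ Transmits (A t) u}
        = Set.range fun i : Fin (s u.2) => (e ⟨(reuse u.1, u.2), i⟩ : ℕ) := by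
      ext t
      simp only [htr, Set.mem_ofPred_eq, Set.mem_range]
      constructor
      · rintro ⟨-, h, hp⟩
        obtain ⟨q, hq⟩ := e.surjective ⟨t, h⟩
        rw [← hq, Equiv.symm_apply_apply] at hp
        obtain ⟨p, i⟩ := q
        obtain rfl : p = (reuse u.1, u.2) := hp
        exact ⟨i, congrArg Fin.val hq⟩
      · rintro ⟨i, rfl⟩
        exact ⟨Fin.is_lt _, Fin.is_lt _, by simp⟩
    rw [this, ← Set.image_univ, Set.ncard_image_of_injective]
    · simp [Set.ncard_univ]
    · intro i j hij
      simpa using e.injective (Fin.ext hij)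

/-! ### The throughput of the scheme -/

theorem numBits_rsScheme {ι V : Type*} [Fintype V] {G : SimpleGraph V} {γ τ m b : ℕ}
    (N : Fin τ → G.Subgraph) (σ : Fin τ → V → V → Fin (2 * γ - 1)) (u : ι × V) :
    (rsScheme ι m N σ b).numBits u = Nat.card {l : Fin τ // u.2 ∈ (N l).verts} * b := by
  classical
  rw [D2DScheme.numBits, ← @Nat.card_eq_fintype_card _ ((rsScheme ι m N σ b).bitFintype u)]
  exact (Nat.card_prod _ _).trans (by simp)

theorem achievesThroughput_rsScheme {ι V : Type*} [Nonempty ι] [Fintype V] [Nontrivial V]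
    {net : D2DNetwork (ι × V)} {κ : ℕ} {reuse : ι → Fin κ} (hreuse : net.IsReusePattern reuse)
    {m : ℕ} (hm : 0 < m) {M : ℝ} {γ τ : ℕ} {G : SimpleGraph V} {N : Fin τ → G.Subgraph}
    (hγ : 1 ≤ γ) (hτ : 1 ≤ τ) (hN : IsRSDecomposition G γ N)
    (hdeg : ∀ v, (Fintype.card V : ℝ) - (Fintype.card V : ℝ) * M / (m : ℝ)
        ≤ ((G.neighborSet v).ncard : ℝ))
    {σ : Fin τ → V → V → Fin (2 * γ - 1)} (hσ : IsPacketLabelling N σ) :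
    AchievesThroughput net M
      (net.linkRate / (κ : ℝ) * ((Fintype.card V : ℝ) / (τ : ℝ)) *
        ((2 * (γ : ℝ) - 1) / (2 * (γ : ℝ))))
      (rsScheme ι m N σ) := by
  refine ⟨ncard_rsScheme_cache_le hm hdeg N σ, fun ε hε => ?_⟩
  have hC := net.linkRate_pos
  have hκ : 0 < κ := (reuse (Classical.arbitrary ι)).pos
  choose dec hdec using fun b => (rsScheme ι m N σ b).exists_decoder_errorProb_eq_zero
    (rsScheme_eq_of_message_eq hN hσ)
  let n : V → ℕ := fun w => Nat.card {l : Fin τ // w ∈ (N l).verts}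
  let s : ℕ → V → ℕ := fun b w => ⌈(n w * b : ℝ) / net.linkRate⌉₊
  choose A hA₁ hA₂ hA₃ using fun b => exists_timeDivision hreuse (s b)
  refine ⟨dec, fun b => κ * ∑ w, s b w, A, fun b => ⟨fun t _ => hA₁ b t, ?_⟩, ?_, ?_⟩
  · rintro v u ⟨h1, h2⟩
    refine ⟨fun t _ => hA₂ b t u v h1.symm h2.symm, ?_⟩
    rw [hA₃, numBits_rsScheme, ← div_le_iff₀' hC]
    push_cast
    exact Nat.le_ceil _
  · intro η hη
    filter_upwards with b
    rw [hdec]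
    positivity
  · intro η hη
    have hg0 : (0 : ℝ) < Fintype.card V := by exact_mod_cast Fintype.card_pos
    set g : ℝ := (Fintype.card V : ℝ) with hg
    have hγ' : (1 : ℝ) ≤ γ := by exact_mod_cast hγ
    have hτ' : (0 : ℝ) < τ := by exact_mod_cast hτ
    have hκ' : (0 : ℝ) < κ := by exact_mod_cast hκ
    have hP : (Fintype.card (V × Fin (2 * γ - 1)) : ℝ) = g * (2 * γ - 1) := by
      rw [Fintype.card_prod, Fintype.card_fin, Nat.cast_mul, Nat.cast_sub (by omega)]
      push_cast
      rfl
    have hq : (0 : ℝ) < 2 * γ - 1 := by linarith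
    have hsum : ∀ b, ((∑ w, s b w : ℕ) : ℝ) ≤ 2 * γ * τ * b / net.linkRate + g := by
      intro b
      have hn : ∑ w, (n w : ℝ) = 2 * γ * τ := by exact_mod_cast hN.sum_card_matchings
      calc ((∑ w, s b w : ℕ) : ℝ) = ∑ w, (s b w : ℝ) := by push_cast; rfl
        _ ≤ ∑ w, ((n w * b : ℝ) / net.linkRate + 1) :=
          Finset.sum_le_sum fun w _ => (Nat.ceil_lt_add_one (by positivity)).le
        _ = 2 * γ * τ * b / net.linkRate + g := by
          rw [Finset.sum_add_distrib, ← Finset.sum_div, ← Finset.sum_mul, hn]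
          simp [hg]
    -- The rounding cost `κ g` must fit into the slack `η F = η g (2γ - 1) b`; this fixes the
    -- threshold for `b`.
    filter_upwards [eventually_ge_atTop ⌈κ / (η * (2 * γ - 1))⌉₊] with b hb
    have hb' : κ ≤ b * (η * (2 * γ - 1)) :=
      (div_le_iff₀ (by positivity)).1 (Nat.ceil_le.1 hb)
    rw [hP]
    calc ((κ * ∑ w, s b w : ℕ) : ℝ) ≤ κ * (2 * γ * τ * b / net.linkRate + g) := by
          rw [Nat.cast_mul]
          gcongr
          exact hsum b
      _ = κ * (2 * γ * τ * b / net.linkRate) + g * κ := by ring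
      _ ≤ κ * (2 * γ * τ * b / net.linkRate) + g * (b * (η * (2 * γ - 1))) := by gcongr
      _ = (1 / (net.linkRate / κ * (g / τ) * ((2 * γ - 1) / (2 * γ))) + η)
            * (g * (2 * γ - 1) * b) := by
          have := hq.ne'
          field_simp

/-! ### Existence of the graph -/

/-- This is `t_c ≥ 1` at the smallest allowed `M`. Since `log Λ ≥ log 2 > 1/2`, the exponent is at
least `-1`, so the power of `g` is at least `1 / g`. -/
theorem one_le_two_mul_card_mul_rpow {Λ : ℕ} (hΛ : 2 ≤ Λ) {g : ℝ} (hg : 1 ≤ g) :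
    1 ≤ g * (2 * g ^ (-(1 / (2 * (Λ : ℝ) ^ 4 * Real.log (Λ : ℝ))))) := by
  have hΛ' : (2 : ℝ) ≤ Λ := by exact_mod_cast hΛ
  have hlog : (1 / 2 : ℝ) ≤ Real.log Λ :=
    (by linarith [Real.log_two_gt_d9] : (1 / 2 : ℝ) ≤ Real.log 2).trans
      (Real.log_le_log (by norm_num) hΛ')
  have hpow : (1 : ℝ) ≤ (Λ : ℝ) ^ 4 := one_le_pow₀ (by linarith)
  have hden : (1 : ℝ) ≤ 2 * (Λ : ℝ) ^ 4 * Real.log Λ := by nlinarith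
  have h1 : g ^ (-1 : ℝ) ≤ g ^ (-(1 / (2 * (Λ : ℝ) ^ 4 * Real.log (Λ : ℝ)))) :=
    Real.rpow_le_rpow_of_exponent_le hg
      (neg_le_neg (by rw [div_le_one (by linarith)]; exact hden))
  rw [Real.rpow_neg_one] at h1
  have h2 : g * g⁻¹ ≤ g * g ^ (-(1 / (2 * (Λ : ℝ) ^ 4 * Real.log (Λ : ℝ)))) := by gcongr
  rw [mul_inv_cancel₀ (by linarith)] at h2
  linarith

theorem ncard_neighborSet_top {V : Type*} [Fintype V] (v : V) :
    ((⊤ : SimpleGraph V).neighborSet v).ncard = Fintype.card V - 1 := by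
  classical
  rw [SimpleGraph.neighborSet_top, Set.ncard_compl, Set.ncard_singleton, Nat.card_eq_fintype_card]

/-- Clusters are indexed by `ι`; each has `g_c = |V| = Λ ^ z` users; `κ` is the reuse factor. -/
theorem theorem2 {ι V : Type*} [Fintype ι] [Nonempty ι] [Fintype V]
    (net : D2DNetwork (ι × V)) (hr : net.r < Real.sqrt 2)
    (κ : ℕ) (reuse : ι → Fin κ) (hreuse : net.IsReusePattern reuse)
    (Λ z : ℕ) (hΛ : 2 ≤ Λ) (hz : 2 * Λ ≤ z) (hV : Fintype.card V = Λ ^ z)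
    (m : ℕ) (hm : 0 < m) (M : ℝ)
    (hM : 2 * (m : ℝ) *
      (Fintype.card V : ℝ) ^ (-(1 / (2 * (Λ : ℝ) ^ 4 * Real.log (Λ : ℝ)))) ≤ M) :
    -- the graph needed by the scheme exists
    (∃ (γ τ : ℕ) (G : SimpleGraph V) (N : Fin τ → G.Subgraph), 1 ≤ γ ∧ 1 ≤ τ ∧
      IsRSDecomposition G γ N ∧
      ∀ v, (Fintype.card V : ℝ) - (Fintype.card V : ℝ) * M / (m : ℝ)
        ≤ ((G.neighborSet v).ncard : ℝ)) ∧
    -- and with every such graph the scheme achieves the claimed throughput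
    ∀ (γ τ : ℕ) (G : SimpleGraph V) (N : Fin τ → G.Subgraph), 1 ≤ γ → 1 ≤ τ →
      IsRSDecomposition G γ N →
      (∀ v, (Fintype.card V : ℝ) - (Fintype.card V : ℝ) * M / (m : ℝ)
        ≤ ((G.neighborSet v).ncard : ℝ)) →
      Fintype.card (V × Fin (2 * γ - 1)) = (2 * γ - 1) * Fintype.card V ∧
      (∃ σ : Fin τ → V → V → Fin (2 * γ - 1), IsPacketLabelling N σ) ∧
      ∀ σ : Fin τ → V → V → Fin (2 * γ - 1), IsPacketLabelling N σ →
        AchievesThroughput net M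
          (net.linkRate / (κ : ℝ) * ((Fintype.card V : ℝ) / (τ : ℝ)) *
            ((2 * (γ : ℝ) - 1) / (2 * (γ : ℝ))))
          (rsScheme ι m N σ) := by
  have hcard : 1 < Fintype.card V := by
    rw [hV]
    exact Nat.one_lt_pow (by omega) (by omega)
  have : Nontrivial V := Fintype.one_lt_card_iff_nontrivial.1 hcard
  refine ⟨?_, fun γ τ G N hγ hτ hN hdeg => ⟨?_, hN.exists_isPacketLabelling hγ, fun σ hσ =>
    achievesThroughput_rsScheme hreuse hm hγ hτ hN hdeg hσ⟩⟩
  · obtain ⟨N, hN⟩ := exists_isRSDecomposition_one (⊤ : SimpleGraph V)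
    -- Here `γ = 1` and `τ` is the number of edges of the complete graph. The degree `|V| - 1`
    -- suffices because `t_c ≥ 1`.
    refine ⟨1, _, ⊤, N, le_rfl, ?_, hN, fun v => ?_⟩
    · obtain ⟨a, b, hab⟩ := exists_pair_ne V
      exact (Set.ncard_pos (Set.toFinite _)).2 ⟨s(a, b), hab⟩
    · have hm' : (0 : ℝ) < m := by exact_mod_cast hm
      have hg : (1 : ℝ) ≤ Fintype.card V := by exact_mod_cast hcard.le
      rw [ncard_neighborSet_top, Nat.cast_sub hcard.le, Nat.cast_one]
      refine sub_le_sub_left ((one_le_two_mul_card_mul_rpow hΛ hg).trans ?_) _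
      rw [mul_div_assoc]
      gcongr
      rw [le_div_iff₀ hm']
      linarith
  · rw [Fintype.card_prod, Fintype.card_fin, mul_comm]
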